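/- Let $\mathbb{K}$ be $\mathbb{R}$ or $\mathbb{C}$, and let $X$ be a Banach space over $\mathbb{K}$ that is an $L_1$-predual, i.e. its dual $X^*$ is isometrically isomorphic (over $\mathbb{K}$) to $L_1(S,\Sigma,\mu)$ for some measure space $(S,\Sigma,\mu)$. Write $B_X$ and $B_{X^*}$ for the closed unit balls of $X$ and $X^*$, and $\operatorname{ext}(B_{X^*})$ for the set of extreme points of $B_{X^*}$. For $f,g\in\operatorname{ext}(B_{X^*})$ let $f\sim g$ if $f$ and $g$ are linearly dependent over $\mathbb{K}$; this is an equivalence relation on $\operatorname{ext}(B_{X^*})$. A slice of a bounded convex set $A\subseteq X$ is a non-empty set of the form $\{x\in A:\operatorname{Re}x^*(x)>\sup_{b\in A}\operatorname{Re}x^*(b)-\alpha\}$ with $x^*\in X^*$ and $\alpha>0$. A point $a\in A$ is an SCD (slicely countably determined) point of $A$ if there is a sequence $(V_n)_{n\in\mathbb{N}}$ of slices of $A$ such that $a\in\overline{\operatorname{conv}}(B)$ for every $B\subseteq A$ that intersects all the sets $V_n$. Let $\mathrm{SCD}(A)$ be the set of SCD points of $A$. Then: (a) if the quotient set $\operatorname{ext}(B_{X^*})/{\sim}$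 is at most countable, then $\mathrm{SCD}(B_X)=B_X$; (b) if $\operatorname{ext}(B_{X^*})/{\sim}$ is uncountable, then $\mathrm{SCD}(B_X)=\emptyset$. -/

import Mathlib

universe w u v

/-- The slice `S(A, f, α) = {x ∈ A : Re f(x) > sup_{b ∈ A} Re f(b) - α}` of a bounded set `A`. -/
def slice {𝕜 X : Type*} [RCLike 𝕜] [NormedAddCommGroup X] [NormedSpace 𝕜 X]
    (A : Set X) (f : StrongDual 𝕜 X) (α : ℝ) : Set X :=
  {x ∈ A | sSup ((fun b => RCLike.re (f b)) '' A) - α < RCLike.re (f x)}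

/-- `S` is a slice of the bounded set `A`: it is nonempty and of the form `S(A, f, α)`
with `f ∈ X*` and `α > 0`. -/
def IsSlice (𝕜 : Type*) {X : Type*} [RCLike 𝕜] [NormedAddCommGroup X] [NormedSpace 𝕜 X]
    (A S : Set X) : Prop :=
  S.Nonempty ∧ ∃ (f : StrongDual 𝕜 X) (α : ℝ), 0 < α ∧ S = slice A f α

/-- The sequence `V` of subsets of `A` is determining for the point `a`: every `B ⊆ A` that
meets all the sets `V n` has `a` in its closed convex hull. -/
def IsDetermining {X : Type*} [NormedAddCommGroup X] [NormedSpace ℝ X]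
    (A : Set X) (V : ℕ → Set X) (a : X) : Prop :=
  ∀ B : Set X, B ⊆ A → (∀ n, (B ∩ V n).Nonempty) → a ∈ closure (convexHull ℝ B)

/-- The set `SCD(A)` of slicely countably determined points of a bounded convex set `A`. -/
def scdPoints (𝕜 : Type*) {X : Type*} [RCLike 𝕜] [NormedAddCommGroup X] [NormedSpace 𝕜 X]
    [NormedSpace ℝ X] (A : Set X) : Set X :=
  {a ∈ A | ∃ V : ℕ → Set X, (∀ n, IsSlice 𝕜 A (V n)) ∧ IsDetermining A V a}

/-- `X` is an `L₁`-predual: `X*` is linearly isometric (over `𝕜`) to `L₁(S, Σ, μ)` for some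
measure space `(S, Σ, μ)`, without any restriction on `μ`. -/
def IsL1Predual (𝕜 : Type u) (X : Type v) [RCLike 𝕜] [NormedAddCommGroup X]
    [NormedSpace 𝕜 X] : Prop :=
  ∃ (S : Type w) (_ : MeasurableSpace S) (μ : MeasureTheory.Measure S),
    Nonempty (StrongDual 𝕜 X ≃ₗᵢ[𝕜] MeasureTheory.Lp 𝕜 1 μ)

/-- The set `ext(B_{X*})` of extreme points of the closed unit ball of the dual. -/
def extDualBall (𝕜 X : Type*) [RCLike 𝕜] [NormedAddCommGroup X] [NormedSpace 𝕜 X] :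
    Set (StrongDual 𝕜 X) :=
  (Metric.closedBall (0 : StrongDual 𝕜 X) 1).extremePoints ℝ

theorem eq_zero_of_zero_mem_extDualBall {𝕜 X : Type*} [RCLike 𝕜] [NormedAddCommGroup X]
    [NormedSpace 𝕜 X] (h : (0 : StrongDual 𝕜 X) ∈ extDualBall 𝕜 X) {f : StrongDual 𝕜 X}
    (hf : f ∈ extDualBall 𝕜 X) : f = 0 := by
  have hb := hf.1
  rw [mem_closedBall_zero_iff] at hb
  refine h.2 (x₁ := f) (x₂ := -f) (by simpa using hb) (by simpa using hb) ?_
  exact ⟨1 / 2, 1 / 2, by norm_num, by norm_num, by norm_num, by simp⟩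

/-- The relation `f ∼ g` on `ext(B_{X*})`: `f` and `g` are linearly dependent over `𝕜`. -/
def extSetoid (𝕜 X : Type*) [RCLike 𝕜] [NormedAddCommGroup X] [NormedSpace 𝕜 X] :
    Setoid (extDualBall 𝕜 X) where
  r f g := ¬ LinearIndependent 𝕜 ![(f : StrongDual 𝕜 X), (g : StrongDual 𝕜 X)]
  iseqv :=
    { refl := fun f h => by
        have := LinearIndependent.pair_iff.1 h 1 (-1) (by simp)
        simp at this
      symm := fun {f g} h h' => h (by
        rw [LinearIndependent.pair_iff] at h' ⊢
        intro s t hst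
        exact (h' t s (by rw [add_comm]; exact hst)).symm)
      trans := fun {f g k} h₁ h₂ h => by
        by_cases hg : (g : StrongDual 𝕜 X) = 0
        · have h0 : (0 : StrongDual 𝕜 X) ∈ extDualBall 𝕜 X := hg ▸ g.2
          exact h.ne_zero 0 (eq_zero_of_zero_mem_extDualBall h0 f.2)
        · have hf : (f : StrongDual 𝕜 X) ≠ 0 := h.ne_zero 0
          have hk : (k : StrongDual 𝕜 X) ≠ 0 := h.ne_zero 1
          rw [LinearIndependent.pair_iff' hf] at h h₁
          rw [LinearIndependent.pair_iff' hg] at h₂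
          push Not at h₁ h₂
          obtain ⟨a, ha⟩ := h₁
          obtain ⟨b, hb⟩ := h₂
          exact h (b * a) (by rw [mul_smul, ha, hb]) }

/-! Countable case: by Krein–Milman every vector is normed by an extreme functional, and picking one
functional per class changes values only by unimodular scalars. This gives a countable family
attaining every norm. By a variational argument (`closure_span_range_eq_univ`) its span is dense in
the dual, so the dual is separable. The slices given by a dense sequence of functionals and the
widths `1/(m+1)` then determine every point of the ball, by Hahn–Banach.

Uncountable case: in `L¹` an extreme point lives on an atom, so inequivalent extreme points have
a.e. disjoint supports, and an integrable function meets only countably many of these. For any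
sequence of slicing functionals some extreme `e` is therefore disjoint from all of them, and the
norms add. Each slice then contains a point where a rotation of `e` has real part above `1/2`. The
rotation can be chosen with nonpositive real part at a prescribed `a`, so `a` is separated from the
closed convex hull of these points. -/

/-! ### Extreme points of a unit ball. -/

theorem mem_extremePoints_ball_norm_eq_one {E : Type*} [NormedAddCommGroup E] [NormedSpace ℝ E]
    {e : E} (he : e ∈ (Metric.closedBall (0 : E) 1).extremePoints ℝ) (h0 : e ≠ 0) : ‖e‖ = 1 := by
  have hpos := norm_pos_iff.2 h0
  have hle := mem_closedBall_zero_iff.1 he.1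
  refine le_antisymm hle (not_lt.1 fun hlt => h0 ?_)
  have := he.2 (x₁ := 0) (x₂ := ‖e‖⁻¹ • e) (by simp)
    (by simp [norm_smul, hpos.ne'])
    ⟨1 - ‖e‖, ‖e‖, by linarith, hpos, by ring, by simp [smul_smul, hpos.ne']⟩
  exact this.symm

/-- For nonzero `u`, the sum is a convex combination of the normalized `u` and `v` with weights
`‖u‖` and `‖v‖`, so extremality identifies both with it. -/
theorem smul_eq_of_mem_extremePoints_ball {E : Type*} [NormedAddCommGroup E] [NormedSpace ℝ E]
    {u v : E} (he : u + v ∈ (Metric.closedBall (0 : E) 1).extremePoints ℝ) (h : ‖u‖ + ‖v‖ = 1)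
    (hv : v ≠ 0) : u = ‖u‖ • (u + v) := by
  rcases eq_or_ne u 0 with rfl | hu
  · simp
  have hu' := norm_pos_iff.2 hu
  have hv' := norm_pos_iff.2 hv
  have := he.2 (x₁ := ‖u‖⁻¹ • u) (x₂ := ‖v‖⁻¹ • v) (by simp [norm_smul, hu'.ne'])
    (by simp [norm_smul, hv'.ne'])
    ⟨‖u‖, ‖v‖, hu', hv', h, by simp [smul_smul, hu'.ne', hv'.ne']⟩
  rw [← this, smul_smul, mul_inv_cancel₀ hu'.ne', one_smul]

/-! ### Ekeland's variational principle and countable norm-attaining families. -/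

/-- Existence of an almost maximum, up to a small cone, of a function bounded above on a closed
set of a complete space. -/
theorem exists_forall_le_add_mul_dist {E : Type*} [MetricSpace E] [CompleteSpace E]
    {C : Set E} (hC : IsClosed C) (hne : C.Nonempty) {φ : E → ℝ} (hφ : Continuous φ)
    (hb : BddAbove (φ '' C)) {ε : ℝ} (hε : 0 < ε) :
    ∃ x ∈ C, ∀ y ∈ C, φ y ≤ φ x + ε * dist x y := by
  -- `S x` is the set of points above `x` in the cone order. Each iterate nearly maximizes `φ` on
  -- the previous `S`, so the sets `S` shrink to a point.
  let S : E → Set E := fun x => {y ∈ C | φ x + ε * dist x y ≤ φ y}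
  have hSb : ∀ x, BddAbove (φ '' S x) := fun x => hb.mono (Set.image_mono fun y hy => hy.1)
  have step : ∀ (n : ℕ) (x : C), ∃ y : C, (y : E) ∈ S x ∧
      ∀ z ∈ S x, φ z < φ y + 1 / ((n : ℝ) + 1) := by
    intro n x
    have hx : (x : E) ∈ S x := ⟨x.2, by simp⟩
    obtain ⟨_, ⟨y, hy, rfl⟩, hlt⟩ := exists_lt_of_lt_csSup (s := φ '' S x) ⟨_, x, hx, rfl⟩
      (sub_lt_self (sSup (φ '' S x)) (Nat.one_div_pos_of_nat (α := ℝ) (n := n)))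
    refine ⟨⟨y, hy.1⟩, hy, fun z hz => ?_⟩
    have := le_csSup (hSb x) ⟨z, hz, rfl⟩
    linarith
  choose g hg hg' using step
  obtain ⟨x₀, hx₀⟩ := hne
  let x : ℕ → C := fun n => Nat.rec ⟨x₀, hx₀⟩ (fun n y => g n y) n
  have hx : ∀ n, (x (n + 1)).1 ∈ S (x n).1 := fun n => hg n (x n)
  have trans : ∀ a b c, b ∈ S a → c ∈ S b → c ∈ S a := by
    rintro a b c ⟨_, h1⟩ ⟨hc, h2⟩
    refine ⟨hc, ?_⟩
    have := mul_le_mul_of_nonneg_left (dist_triangle a b c) hε.le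
    linarith
  have hmem : ∀ n m, n ≤ m → (x m).1 ∈ S (x n).1 := by
    intro n m h
    induction m, h using Nat.le_induction with
    | base => exact ⟨(x n).2, by simp⟩
    | succ m _ ih => exact trans _ _ _ ih (hx m)
  have hdist : ∀ n, ∀ z ∈ S (x (n + 1)).1, dist (x (n + 1)).1 z ≤ (1 / ((n : ℝ) + 1)) / ε := by
    intro n z hz
    have h1 := hg' n (x n) z (trans _ _ _ (hx n) hz)
    have h2 := hz.2
    rw [le_div_iff₀ hε, mul_comm]
    change φ z < φ (x (n + 1)).1 + _ at h1
    linarith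
  have hlim : Filter.Tendsto (fun n : ℕ => (1 / ((n : ℝ) + 1)) / ε) Filter.atTop (nhds 0) := by
    simpa using tendsto_one_div_add_atTop_nhds_zero_nat.div_const ε
  have hcau : CauchySeq fun n => (x (n + 1)).1 :=
    cauchySeq_of_le_tendsto_0' _ (fun n m h => hdist n _ (hmem (n + 1) (m + 1) (by omega))) hlim
  obtain ⟨l, hl⟩ := cauchySeq_tendsto_of_complete hcau
  have hSc : ∀ a, IsClosed (S a) := fun a => hC.inter
    (isClosed_le (by fun_prop) hφ)
  have hlS : ∀ n, l ∈ S (x (n + 1)).1 := fun n => (hSc _).mem_of_tendsto hl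
    (Filter.eventually_atTop.2 ⟨n, fun m h => hmem (n + 1) (m + 1) (by omega)⟩)
  refine ⟨l, (hlS 0).1, fun y hy => ?_⟩
  -- A violating `y` lies in every `S (x (n + 1))`, so the sequence also converges to `y`; this
  -- forces `y = l`.
  by_contra! hlt
  have hyl : y ∈ S l := ⟨hy, hlt.le⟩
  have : Filter.Tendsto (fun n => (x (n + 1)).1) Filter.atTop (nhds y) :=
    tendsto_iff_dist_tendsto_zero.2 (squeeze_zero (fun _ => dist_nonneg)
      (fun n => hdist n y (trans _ _ _ (hlS n) hyl)) hlim)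
  have := tendsto_nhds_unique hl this
  subst this
  simp at hlt

/-- A Banach space with a countable norm-attaining family in the dual ball: the family spans a dense
subspace of the dual. -/
theorem closure_span_range_eq_univ {𝕜 X : Type*} [RCLike 𝕜] [NormedAddCommGroup X]
    [NormedSpace 𝕜 X] [CompleteSpace X] (e : ℕ → StrongDual 𝕜 X) (he : ∀ n, ‖e n‖ ≤ 1)
    (hatt : ∀ x, ∃ n, ‖e n x‖ = ‖x‖) :
    closure (Submodule.span 𝕜 (Set.range e) : Set (StrongDual 𝕜 X)) = Set.univ := by
  refine Set.eq_univ_of_forall fun f => Metric.mem_closure_iff.2 fun ε hε => ?_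
  -- Weights above 1 push `C` into the open unit ball, as every norm is attained by some `e n`.
  -- Their decrease to 1 leaves uniform slack at a given point of `C` in all but finitely many
  -- constraints.
  let w : ℕ → ℝ := fun n => 1 + 1 / ((n : ℝ) + 1)
  have hw : ∀ n, 1 < w n := fun n => lt_add_of_pos_right _ Nat.one_div_pos_of_nat
  have hanti : ∀ n m, n ≤ m → w m ≤ w n := fun n m h => by
    simpa [w] using Nat.one_div_le_one_div (α := ℝ) h
  have hwlim : Filter.Tendsto w Filter.atTop (nhds 1) := by
    simpa [w] using (tendsto_one_div_add_atTop_nhds_zero_nat (𝕜 := ℝ)).const_add 1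
  have hex : ∀ n x, ‖e n x‖ ≤ ‖x‖ := fun n x => by
    simpa using (e n).le_of_opNorm_le (he n) x
  let C : Set X := {x | ∀ n, w n * ‖e n x‖ ≤ 1}
  have hCc : IsClosed C := by
    simp only [C, Set.ofPred_forall]
    exact isClosed_iInter fun n => isClosed_le (by fun_prop) continuous_const
  have hC1 : ∀ x ∈ C, ‖x‖ < 1 := by
    intro x hx
    obtain ⟨n, hn⟩ := hatt x
    have := hx n
    rw [hn] at this
    nlinarith [hw n, norm_nonneg x]
  have hbdd : BddAbove ((fun x => RCLike.re (f x)) '' C) := by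
    refine ⟨‖f‖, ?_⟩
    rintro _ ⟨x, hx, rfl⟩
    exact (RCLike.re_le_norm _).trans (f.unit_le_opNorm _ (hC1 x hx).le)
  obtain ⟨x, hxC, hx⟩ := exists_forall_le_add_mul_dist hCc ⟨0, by simp [C]⟩
    (φ := fun x => RCLike.re (f x)) (by fun_prop) hbdd (half_pos hε)
  obtain ⟨N, hN⟩ : ∃ N, w N * ‖x‖ < 1 := by
    have : Filter.Tendsto (fun n => w n * ‖x‖) Filter.atTop (nhds (1 * ‖x‖)) :=
      hwlim.mul_const _
    exact (this.eventually_lt_const (by simpa using hC1 x hxC)).exists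
  -- Chosen so that `w N * (‖x‖ + δ) = 1`: a move of length at most `δ` respects the constraints
  -- from `N` on, and a move in `W` leaves the earlier ones unchanged.
  let δ := (1 - w N * ‖x‖) / w N
  have hwN : 0 < w N := zero_lt_one.trans (hw N)
  have hδ : 0 < δ := div_pos (by linarith) hwN
  let W : Submodule 𝕜 X := ⨅ i : Fin N, LinearMap.ker (e i : X →ₗ[𝕜] 𝕜)
  have hWm : ∀ y, y ∈ W ↔ ∀ n < N, e n y = 0 := fun y => by
    simp [W, Submodule.mem_iInf, Fin.forall_iff]
  have key : ∀ y ∈ W, ‖y‖ ≤ δ → RCLike.re (f y) ≤ ε / 2 * ‖y‖ := by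
    intro y hy hyd
    have hC : x + y ∈ C := by
      intro n
      rcases lt_or_ge n N with h | h
      · simpa [(hWm y).1 hy n h] using hxC n
      · calc w n * ‖e n (x + y)‖ ≤ w N * (‖x‖ + δ) := by
              gcongr
              · exact hanti _ _ h
              · exact (hex _ _).trans ((norm_add_le _ _).trans (by gcongr))
          _ = 1 := by simp only [δ]; field_simp; ring
    have := hx _ hC
    simp only [map_add, dist_self_add_right] at this
    linarith
  have key2 : ∀ y ∈ W, RCLike.re (f y) ≤ ε / 2 * ‖y‖ := by
    intro y hy
    rcases eq_or_ne y 0 with rfl | h0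
    · simp
    have hy0 := norm_pos_iff.2 h0
    set c : ℝ := δ / ‖y‖ with hc
    have hc0 : 0 < c := div_pos hδ hy0
    have hn : ‖(c : 𝕜) • y‖ = c * ‖y‖ := by simp [norm_smul, abs_of_pos hc0]
    have := key ((c : 𝕜) • y) (W.smul_mem _ hy) (by rw [hn, hc]; field_simp; rfl)
    rw [hn, map_smul, smul_eq_mul, RCLike.re_ofReal_mul] at this
    nlinarith
  have key3 : ∀ y ∈ W, ‖f y‖ ≤ ε / 2 * ‖y‖ := by
    intro y hy
    obtain ⟨c, hc, hcy⟩ := RCLike.exists_norm_eq_mul_self (f y)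
    have := key2 (c • y) (W.smul_mem _ hy)
    rw [map_smul, smul_eq_mul, ← hcy, norm_smul, hc] at this
    simpa using this
  -- The restriction of `f` to `W` has norm at most `ε / 2`. Subtracting a norm-preserving extension
  -- leaves a functional vanishing on `W`, hence a combination of the first `N` functionals.
  obtain ⟨g, hg, hgn⟩ := exists_extension_norm_eq W (f.comp W.subtypeL)
  have hgn' : ‖g‖ ≤ ε / 2 := by
    rw [hgn]
    exact ContinuousLinearMap.opNorm_le_bound _ (half_pos hε).le fun y => key3 y y.2
  refine ⟨f - g, ?_, by rw [dist_eq_norm]; simpa using hgn'.trans_lt (half_lt_self hε)⟩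
  have hmem : ((f - g : StrongDual 𝕜 X) : X →ₗ[𝕜] 𝕜) ∈
      Submodule.span 𝕜 (Set.range fun i : Fin N => (e i : X →ₗ[𝕜] 𝕜)) := by
    refine mem_span_of_iInf_ker_le_ker fun y hy => ?_
    have := hg ⟨y, hy⟩
    simp at this
    simp [this]
  have hrange : (Set.range fun i : Fin N => (e i : X →ₗ[𝕜] 𝕜)) =
      ContinuousLinearMap.coeLM 𝕜 '' Set.range (fun i : Fin N => e i) := by
    rw [← Set.range_comp]; rfl
  rw [hrange, Submodule.span_image] at hmem
  obtain ⟨h, hh, hfg⟩ := hmem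
  have : h = f - g := ContinuousLinearMap.coe_injective hfg
  rw [← this]
  exact Submodule.span_mono (by rintro _ ⟨i, rfl⟩; exact ⟨i, rfl⟩) hh

/-- The functionals norming `x` form a nonempty weak-* compact face of the dual ball. Krein–Milman
gives an extreme point of the face, and it is extreme in the ball. -/
theorem exists_extreme_re_apply_eq_norm {𝕜 X : Type*} [RCLike 𝕜] [NormedAddCommGroup X]
    [NormedSpace 𝕜 X] (x : X) : ∃ g ∈ extDualBall 𝕜 X, RCLike.re (g x) = ‖x‖ := by
  let B : Set (WeakDual 𝕜 X) := WeakDual.toStrongDual ⁻¹' Metric.closedBall 0 1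
  have hB : IsCompact B := WeakDual.isCompact_closedBall _ _
  let F : Set (WeakDual 𝕜 X) := B ∩ {g | RCLike.re (g x) = ‖x‖}
  have hFc : IsCompact F := hB.inter_right
    (isClosed_eq (RCLike.continuous_re.comp (WeakDual.eval_continuous x)) continuous_const)
  have hF0 : F.Nonempty := by
    obtain ⟨g, hg, hgx⟩ := exists_dual_vector'' 𝕜 x
    exact ⟨StrongDual.toWeakDual g, mem_closedBall_zero_iff.2 hg, by
      change RCLike.re (g x) = _; simp [hgx]⟩
  have : LocallyConvexSpace ℝ (WeakDual 𝕜 X) :=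
    inferInstanceAs (LocallyConvexSpace ℝ (WeakBilin (topDualPairing 𝕜 X)))
  obtain ⟨g, hg⟩ := hFc.extremePoints_nonempty hF0
  refine ⟨WeakDual.toStrongDual g, ⟨hg.1.1, ?_⟩, hg.1.2⟩
  have hle : ∀ h ∈ Metric.closedBall (0 : StrongDual 𝕜 X) 1, RCLike.re (h x) ≤ ‖x‖ := fun h hh =>
    (RCLike.re_le_norm _).trans (by simpa using h.le_of_opNorm_le (mem_closedBall_zero_iff.1 hh) x)
  rintro u hu v hv ⟨a, b, ha, hb, hab, huv⟩
  have h1 : a * RCLike.re (u x) + b * RCLike.re (v x) = ‖x‖ := by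
    rw [← hg.1.2]
    change _ = RCLike.re (WeakDual.toStrongDual g x)
    rw [← huv]
    simp [RCLike.smul_re]
  have hu1 := hle u hu
  have hv1 := hle v hv
  have hux : RCLike.re (u x) = ‖x‖ := by
    refine le_antisymm hu1 (not_lt.1 fun hlt => ?_)
    have h2 := congrArg (· * ‖x‖) hab
    linarith [mul_lt_mul_of_pos_left hlt ha, mul_le_mul_of_nonneg_left hv1 hb.le]
  have hvx : RCLike.re (v x) = ‖x‖ := by
    refine le_antisymm hv1 (not_lt.1 fun hlt => ?_)
    have h2 := congrArg (· * ‖x‖) hab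
    linarith [mul_lt_mul_of_pos_left hlt hb, mul_le_mul_of_nonneg_left hu1 ha.le]
  exact hg.2 (x₁ := StrongDual.toWeakDual u) ⟨hu, hux⟩ (x₂ := StrongDual.toWeakDual v) ⟨hv, hvx⟩
    ⟨a, b, ha, hb, hab, congrArg StrongDual.toWeakDual huv⟩

/-! ### The countable case: separable duals. -/

theorem scdPoints_closedBall_eq_of_separable {𝕜 X : Type*} [RCLike 𝕜] [NormedAddCommGroup X]
    [NormedSpace 𝕜 X] [NormedSpace ℝ X] [IsScalarTower ℝ 𝕜 X]
    [TopologicalSpace.SeparableSpace (StrongDual 𝕜 X)] :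
    scdPoints 𝕜 (Metric.closedBall (0 : X) 1) = Metric.closedBall (0 : X) 1 := by
  refine Set.Subset.antisymm (fun a ha => ha.1) fun a ha => ⟨ha, ?_⟩
  set A := Metric.closedBall (0 : X) 1 with hA
  have hbdd : ∀ f : StrongDual 𝕜 X, BddAbove ((fun b => RCLike.re (f b)) '' A) := by
    refine fun f => ⟨‖f‖, ?_⟩
    rintro _ ⟨x, hx, rfl⟩
    exact (RCLike.re_le_norm _).trans (f.unit_le_opNorm _ (mem_closedBall_zero_iff.1 hx))
  let d := TopologicalSpace.denseSeq (StrongDual 𝕜 X)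
  refine ⟨fun k => slice A (d k.unpair.1) (1 / ((k.unpair.2 : ℝ) + 1)), fun k => ⟨?_, _, _,
    Nat.one_div_pos_of_nat, rfl⟩, fun B hBA hB => ?_⟩
  · obtain ⟨_, ⟨x, hx, rfl⟩, hlt⟩ := exists_lt_of_lt_csSup
      (s := (fun b => RCLike.re (d k.unpair.1 b)) '' A) ⟨_, a, ha, rfl⟩
      (sub_lt_self _ (Nat.one_div_pos_of_nat (α := ℝ) (n := k.unpair.2)))
    exact ⟨x, hx, hlt⟩
  · by_contra hnot
    obtain ⟨f, u, hfu, hua⟩ := RCLike.geometric_hahn_banach_closed_point (𝕜 := 𝕜)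
      (convex_convexHull ℝ B).closure isClosed_closure hnot
    -- One third of the gap for each of three errors: approximating `f` at `a`, approximating it at
    -- `b`, and the slice width.
    set ε := (RCLike.re (f a) - u) / 3 with hε
    have hε0 : 0 < ε := by linarith
    obtain ⟨n, hn⟩ := (TopologicalSpace.denseRange_denseSeq (StrongDual 𝕜 X)).exists_dist_lt f hε0
    obtain ⟨m, hm⟩ := exists_nat_one_div_lt hε0
    have hclose : ∀ x ∈ A, |RCLike.re (f x) - RCLike.re (d n x)| ≤ ε := by
      intro x hx
      rw [← map_sub]
      refine (RCLike.abs_re_le_norm _).trans ?_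
      rw [← sub_apply]
      refine ((f - d n).unit_le_opNorm _ (mem_closedBall_zero_iff.1 hx)).trans ?_
      rw [← dist_eq_norm]
      exact hn.le
    obtain ⟨b, hbB, hbA, hb⟩ := hB (Nat.pair n m)
    simp only [Nat.unpair_pair] at hb
    have h1 := le_csSup (hbdd (d n)) ⟨a, ha, rfl⟩
    have h2 := abs_le.1 (hclose a ha)
    have h3 := abs_le.1 (hclose b hbA)
    have h4 := hfu b (subset_closure (subset_convexHull ℝ B hbB))
    simp only at h1
    linarith [h2.1, h2.2, h3.1, h3.2]

theorem exists_smul_eq_of_extSetoid {𝕜 X : Type*} [RCLike 𝕜] [NormedAddCommGroup X]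
    [NormedSpace 𝕜 X] {f g : extDualBall 𝕜 X} (h : extSetoid 𝕜 X f g) :
    ∃ c : 𝕜, c • (f : StrongDual 𝕜 X) = g := by
  by_cases hf : (f : StrongDual 𝕜 X) = 0
  · exact ⟨0, by rw [eq_zero_of_zero_mem_extDualBall (hf ▸ f.2) g.2]; exact zero_smul 𝕜 (f : StrongDual 𝕜 X)⟩
  · change ¬ LinearIndependent _ _ at h
    rw [LinearIndependent.pair_iff' hf] at h
    push Not at h
    exact h

theorem separableSpace_strongDual_of_countable {𝕜 X : Type*} [RCLike 𝕜] [NormedAddCommGroup X]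
    [NormedSpace 𝕜 X] [CompleteSpace X] [Countable (Quotient (extSetoid 𝕜 X))] :
    TopologicalSpace.SeparableSpace (StrongDual 𝕜 X) := by
  obtain ⟨g₀, hg₀, -⟩ := exists_extreme_re_apply_eq_norm (𝕜 := 𝕜) (0 : X)
  have : Nonempty (Quotient (extSetoid 𝕜 X)) := ⟨⟦⟨g₀, hg₀⟩⟧⟩
  obtain ⟨s, hs⟩ := exists_surjective_nat (Quotient (extSetoid 𝕜 X))
  let e : ℕ → StrongDual 𝕜 X := fun n => (s n).out
  have hd := closure_span_range_eq_univ e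
    (fun n => mem_closedBall_zero_iff.1 (s n).out.2.1) fun x => by
      obtain ⟨g, hg, hgx⟩ := exists_extreme_re_apply_eq_norm (𝕜 := 𝕜) x
      obtain ⟨n, hn⟩ := hs ⟦⟨g, hg⟩⟧
      obtain ⟨c, hc⟩ := exists_smul_eq_of_extSetoid (Quotient.exact ((s n).out_eq.trans hn))
      change c • e n = g at hc
      refine ⟨n, ?_⟩
      have hle := (e n).le_of_opNorm_le (mem_closedBall_zero_iff.1 (s n).out.2.1) x
      rw [one_mul] at hle
      refine le_antisymm hle ?_
      -- Zero can be an extreme point, but only when the dual is trivial; otherwise both functionals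
      -- have norm one and `c` is unimodular.
      rcases eq_or_ne g 0 with h0 | h0
      · rw [← hgx, h0]; simp
      have hen : e n ≠ 0 := fun h => h0 (by rw [← hc, h]; exact smul_zero (A := StrongDual 𝕜 X) c)
      have h1 : ‖c‖ = 1 := by
        have := mem_extremePoints_ball_norm_eq_one hg h0
        rw [← hc, norm_smul, mem_extremePoints_ball_norm_eq_one (s n).out.2 hen, mul_one] at this
        exact this
      calc ‖x‖ = RCLike.re (g x) := hgx.symm
        _ ≤ ‖g x‖ := RCLike.re_le_norm _
        _ = ‖e n x‖ := by rw [← hc]; simp [h1]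
  rw [← TopologicalSpace.isSeparable_univ_iff, ← hd]
  exact ((Set.countable_range e).isSeparable.span (R := 𝕜)).closure

theorem LinearIsometryEquiv.map_mem_extremePoints_closedBall {𝕜 E F : Type*} [RCLike 𝕜]
    [NormedAddCommGroup E] [NormedSpace 𝕜 E] [NormedSpace ℝ E] [IsScalarTower ℝ 𝕜 E]
    [NormedAddCommGroup F] [NormedSpace 𝕜 F] [NormedSpace ℝ F] [IsScalarTower ℝ 𝕜 F]
    (Φ : E ≃ₗᵢ[𝕜] F) {e : E} (he : e ∈ (Metric.closedBall (0 : E) 1).extremePoints ℝ) :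
    Φ e ∈ (Metric.closedBall (0 : F) 1).extremePoints ℝ := by
  refine ⟨by simpa using he.1, ?_⟩
  rintro y hy z hz ⟨a, b, ha, hb, hab, hyz⟩
  have := he.2 (x₁ := Φ.symm y) (x₂ := Φ.symm z) (by simpa using hy) (by simpa using hz)
    ⟨a, b, ha, hb, hab, by
      rw [← Φ.symm_apply_apply e, ← hyz]
      simp only [RCLike.real_smul_eq_coe_smul (K := 𝕜), map_add, map_smul]⟩
  rw [← this, Φ.apply_symm_apply]

/-! ### Extreme points of the unit ball of `L¹`. -/

namespace MeasureTheory

variable {𝕜 S : Type*} [RCLike 𝕜] [MeasurableSpace S] {μ : Measure S}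

theorem L1.norm_add_of_ae_eq_zero_or {u v : Lp 𝕜 1 μ} (h : ∀ᵐ x ∂μ, u x = 0 ∨ v x = 0) :
    ‖u + v‖ = ‖u‖ + ‖v‖ := by
  have hi := MeasureTheory.integral_add (f := fun x => ‖u x‖) (g := fun x => ‖v x‖)
    (L1.integrable_coeFn u).norm (L1.integrable_coeFn v).norm
  rw [L1.norm_eq_integral_norm, L1.norm_eq_integral_norm, L1.norm_eq_integral_norm, ← hi]
  refine integral_congr_ae ?_
  filter_upwards [h, Lp.coeFn_add u v] with x hx hadd
  rw [hadd, Pi.add_apply]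
  rcases hx with hx | hx <;> simp [hx]

/-- An extreme point of the unit ball of `L¹` is concentrated on an atom. -/
theorem ae_eq_zero_or_of_mem_extremePoints {u : Lp 𝕜 1 μ}
    (hu : u ∈ (Metric.closedBall (0 : Lp 𝕜 1 μ) 1).extremePoints ℝ) {A : Set S}
    (hA : MeasurableSet A) :
    (∀ᵐ x ∂μ, x ∈ A → u x = 0) ∨ (∀ᵐ x ∂μ, x ∉ A → u x = 0) := by
  rcases eq_or_ne u 0 with rfl | hu0
  · left
    filter_upwards [Lp.coeFn_zero 𝕜 1 μ] with x hx _
    simpa using hx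
  let v : Lp 𝕜 1 μ := ((Lp.memLp u).indicator hA).toLp _
  let w : Lp 𝕜 1 μ := ((Lp.memLp u).indicator hA.compl).toLp _
  have hv : v =ᵐ[μ] A.indicator u := MemLp.coeFn_toLp _
  have hw : w =ᵐ[μ] Aᶜ.indicator u := MemLp.coeFn_toLp _
  have hvw : u = v + w := by
    refine Lp.ext ?_
    filter_upwards [hv, hw, Lp.coeFn_add v w] with x h1 h2 h3
    rw [h3, Pi.add_apply, h1, h2]
    by_cases hx : x ∈ A <;> simp [hx]
  have hn : ‖v‖ + ‖w‖ = 1 := by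
    rw [← mem_extremePoints_ball_norm_eq_one hu hu0, hvw, L1.norm_add_of_ae_eq_zero_or]
    filter_upwards [hv, hw] with x h1 h2
    rw [h1, h2]
    by_cases hx : x ∈ A <;> simp [hx]
  by_cases hw0 : w = 0
  · right
    rw [hw0] at hw
    filter_upwards [hw, Lp.coeFn_zero 𝕜 1 μ] with x h1 h2 hx
    rw [h2] at h1
    simpa [hx] using h1.symm
  -- The part `v` of `u` on `A` equals `‖v‖ • u`, so unless `v = 0` the function `u` vanishes
  -- wherever `v` does, in particular off `A`.
  have heq := smul_eq_of_mem_extremePoints_ball (hvw ▸ hu) hn hw0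
  rw [← hvw] at heq
  by_cases hv0 : v = 0
  · left
    rw [hv0] at hv
    filter_upwards [hv, Lp.coeFn_zero 𝕜 1 μ] with x h1 h2 hx
    rw [h2] at h1
    simpa [hx] using h1.symm
  · right
    have h3 := Lp.coeFn_smul ‖v‖ u
    rw [← heq] at h3
    filter_upwards [hv, h3] with x h1 h2 hx
    rw [h1] at h2
    simpa [hx, hv0] using h2.symm

/-- Two extreme points of the unit ball of `L¹` have disjoint supports or are proportional. -/
theorem exists_smul_eq_of_mem_extremePoints {u v : Lp 𝕜 1 μ}
    (hu : u ∈ (Metric.closedBall (0 : Lp 𝕜 1 μ) 1).extremePoints ℝ)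
    (hv : v ∈ (Metric.closedBall (0 : Lp 𝕜 1 μ) 1).extremePoints ℝ)
    (h : ¬ ∀ᵐ x ∂μ, u x = 0 ∨ v x = 0) : ∃ c : 𝕜, v = c • u := by
  have hum : Measurable u := (Lp.stronglyMeasurable u).measurable
  have hvm : Measurable v := (Lp.stronglyMeasurable v).measurable
  have hUm : MeasurableSet {x | u x ≠ 0} := hum (measurableSet_singleton 0).compl
  have hVm : MeasurableSet {x | v x ≠ 0} := hvm (measurableSet_singleton 0).compl
  have huv : ∀ᵐ x ∂μ, u x = 0 → v x = 0 := by
    rcases ae_eq_zero_or_of_mem_extremePoints hv hUm with h1 | h1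
    · refine absurd (h1.mono fun x hx => ?_) h
      exact or_iff_not_imp_left.2 hx
    · exact h1.mono fun x hx h0 => hx (not_not.2 h0)
  -- On the support of `u`, an atom, each measurable set is null or conull, so the measurable ratio
  -- `v / u` is a.e. constant.
  obtain ⟨c, hc⟩ := Filter.exists_eventuallyEq_const_of_forall_separating
    (l := ae (μ.restrict {x | u x ≠ 0})) (f := fun x => v x / u x) MeasurableSet fun U hU => by
      rw [ae_restrict_iff' hUm, ae_restrict_iff' hUm]
      rcases ae_eq_zero_or_of_mem_extremePoints hu ((hvm.div hum) hU) with h1 | h1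
      · exact Or.inr (h1.mono fun x hx h0 hxU => h0 (hx hxU))
      · exact Or.inl (h1.mono fun x hx h0 => not_not.1 fun hxU => h0 (hx hxU))
  refine ⟨c, Lp.ext ?_⟩
  have hc' := (ae_restrict_iff' hUm).1 hc
  filter_upwards [hc', huv, Lp.coeFn_smul c u] with x h1 h2 h3
  rw [h3, Pi.smul_apply, smul_eq_mul]
  by_cases h0 : u x = 0
  · rw [h2 h0, h0, mul_zero]
  · have := h1 h0
    simp only [Function.const_apply] at this
    rw [← this, div_mul_cancel₀ _ h0]

/-- An integrable function meets only countably many of a family of functions with almost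
everywhere disjoint supports. -/
theorem countable_not_ae_eq_zero_or {ι : Type*} (u : ι → Lp 𝕜 1 μ)
    (hu : Pairwise fun i j => ∀ᵐ x ∂μ, u i x = 0 ∨ u j x = 0) (f : Lp 𝕜 1 μ) :
    {i | ¬ ∀ᵐ x ∂μ, f x = 0 ∨ u i x = 0}.Countable := by
  -- This measure is finite even when `μ` is not σ-finite, so only countably many of the disjoint
  -- supports have positive mass.
  let ν := μ.withDensity fun x => ‖f x‖ₑ
  have hfm : Measurable fun x => ‖f x‖ₑ := (Lp.stronglyMeasurable f).measurable.enorm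
  have : IsFiniteMeasure ν := isFiniteMeasure_withDensity (L1.integrable_coeFn f).2.ne
  have hum : ∀ i, MeasurableSet {x | u i x ≠ 0} := fun i =>
    (Lp.stronglyMeasurable (u i)).measurable (measurableSet_singleton 0).compl
  refine (Measure.countable_meas_pos_of_disjoint_iUnion₀ (μ := ν) (As := fun i => {x | u i x ≠ 0})
    (fun i => (hum i).nullMeasurableSet) fun i j hij => ?_).mono fun i hi => ?_
  · refine withDensity_absolutelyContinuous _ _ ?_
    have h0 : ∀ᵐ x ∂μ, u i x = 0 ∨ u j x = 0 := hu hij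
    rw [ae_iff] at h0
    convert h0 using 2
    ext x
    simp
  · change 0 < ν {x | u i x ≠ 0}
    refine pos_iff_ne_zero.2 fun h0 => hi ?_
    rw [withDensity_apply_eq_zero' hfm.aemeasurable] at h0
    rw [ae_iff]
    convert h0 using 2
    ext x
    simp

end MeasureTheory

/-! ### The uncountable case: a functional disjoint from a given sequence. -/

theorem exists_norm_add_smul_eq_of_uncountable {𝕜 : Type u} {X : Type v} [RCLike 𝕜]
    [NormedAddCommGroup X] [NormedSpace 𝕜 X] (hX : IsL1Predual.{w, u, v} 𝕜 X)
    [Uncountable (Quotient (extSetoid 𝕜 X))] (f : ℕ → StrongDual 𝕜 X) :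
    ∃ e : StrongDual 𝕜 X, ‖e‖ = 1 ∧ ∀ n (c : 𝕜), ‖f n + c • e‖ = ‖f n‖ + ‖c‖ := by
  obtain ⟨S, _, μ, ⟨Φ⟩⟩ := hX
  let u : Quotient (extSetoid 𝕜 X) → MeasureTheory.Lp 𝕜 1 μ := fun q => Φ q.out
  have hu : ∀ q, u q ∈ (Metric.closedBall (0 : MeasureTheory.Lp 𝕜 1 μ) 1).extremePoints ℝ :=
    fun q => Φ.map_mem_extremePoints_closedBall q.out.2
  -- If zero were extreme it would be the only extreme point, leaving a single class.
  have hne : ∀ q : Quotient (extSetoid 𝕜 X), (q.out : StrongDual 𝕜 X) ≠ 0 := by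
    intro q h0
    obtain ⟨q', hq'⟩ := exists_ne q
    refine hq' ?_
    rw [← q.out_eq, ← q'.out_eq]
    have := eq_zero_of_zero_mem_extDualBall (h0 ▸ q.out.2) q'.out.2
    rw [Subtype.ext (this.trans h0.symm)]
  have hdisj : Pairwise fun p q => ∀ᵐ x ∂μ, u p x = 0 ∨ u q x = 0 := by
    intro p q hpq
    by_contra hnot
    obtain ⟨c, hc⟩ := MeasureTheory.exists_smul_eq_of_mem_extremePoints (hu p) (hu q) hnot
    refine hpq ?_
    rw [← p.out_eq, ← q.out_eq]
    refine Quotient.sound ?_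
    change ¬ LinearIndependent _ _
    rw [LinearIndependent.pair_iff' (hne p)]
    push Not
    refine ⟨c, Φ.injective ?_⟩
    rw [map_smul]
    exact hc.symm
  have hcount := Set.countable_iUnion fun n =>
    MeasureTheory.countable_not_ae_eq_zero_or u hdisj (Φ (f n))
  obtain ⟨q, hq⟩ := (Set.ne_univ_iff_exists_notMem _).1 fun h =>
    Set.not_countable_univ ((congrArg Set.Countable h).mp hcount)
  have h1 : ‖(q.out : StrongDual 𝕜 X)‖ = 1 := mem_extremePoints_ball_norm_eq_one q.out.2 (hne q)
  refine ⟨q.out, h1, fun n c => ?_⟩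
  have hd : ∀ᵐ x ∂μ, Φ (f n) x = 0 ∨ u q x = 0 := by
    simp only [Set.mem_iUnion, not_exists] at hq
    exact not_not.1 (hq n)
  have hd' : ∀ᵐ x ∂μ, Φ (f n) x = 0 ∨ (c • u q) x = 0 := by
    filter_upwards [hd, MeasureTheory.Lp.coeFn_smul c (u q)] with x hx hs
    refine hx.imp_right fun h => ?_
    rw [hs, Pi.smul_apply, h, smul_zero]
  have := MeasureTheory.L1.norm_add_of_ae_eq_zero_or hd'
  rw [← map_smul, ← map_add, Φ.norm_map, Φ.norm_map, Φ.norm_map, norm_smul, h1, mul_one] at this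
  exact this

/-- If every sequence of functionals admits a norm-one functional spanning an `ℓ₁`-sum with all of
them, then the unit ball has no slicely countably determined point. -/
theorem scdPoints_closedBall_eq_empty {𝕜 X : Type*} [RCLike 𝕜]
    [NormedAddCommGroup X] [NormedSpace 𝕜 X] [NormedSpace ℝ X] [IsScalarTower ℝ 𝕜 X]
    (h : ∀ f : ℕ → StrongDual 𝕜 X, ∃ e : StrongDual 𝕜 X, ‖e‖ = 1 ∧
      ∀ n (c : 𝕜), ‖f n + c • e‖ = ‖f n‖ + ‖c‖) :
    scdPoints 𝕜 (Metric.closedBall (0 : X) 1) = ∅ := by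
  refine Set.eq_empty_iff_forall_notMem.2 ?_
  rintro a ⟨-, V, hV, hdet⟩
  choose _ f α hα hVs using hV
  obtain ⟨e, he1, he⟩ := h f
  -- The rotation makes `g a = -‖e a‖`, whatever the point `a`.
  obtain ⟨c, hc, hca⟩ := RCLike.exists_norm_eq_mul_self (e a)
  set g : StrongDual 𝕜 X := (-c) • e with hg
  have hg1 : ‖g‖ = 1 := by rw [hg, norm_smul, norm_neg, hc, he1, mul_one]
  have hga : RCLike.re (g a) ≤ 0 := by
    have : g a = -(‖e a‖ : 𝕜) := by rw [hca]; simp [hg]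
    rw [this]
    simp
  have hx : ∀ n, ∃ x ∈ Metric.closedBall (0 : X) 1, ‖f n‖ - α n < RCLike.re (f n x) ∧
      1 / 2 < RCLike.re (g x) := by
    intro n
    have hn : ‖f n + g‖ = ‖f n‖ + 1 := by rw [hg, he, norm_neg, hc]
    -- A vector norming `f n + g` up to this deficit norms each summand up to the same deficit,
    -- since neither real part exceeds the norm of its functional.
    have hδ : 0 < min (α n) (1 / 2) := lt_min (hα n) (by norm_num)
    obtain ⟨y, hy, hlt⟩ := (f n + g).exists_lt_apply_of_lt_opNorm
      (r := ‖f n‖ + 1 - min (α n) (1 / 2)) (by rw [hn]; linarith)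
    obtain ⟨d, hd, hdy⟩ := RCLike.exists_norm_eq_mul_self ((f n + g) y)
    have hx1 : ‖d • y‖ ≤ 1 := by rw [norm_smul, hd, one_mul]; exact hy.le
    have hsum : RCLike.re (f n (d • y)) + RCLike.re (g (d • y)) = ‖(f n + g) y‖ := by
      rw [← map_add, ← add_apply, map_smul, smul_eq_mul, ← hdy, RCLike.ofReal_re]
    have h1 := (RCLike.re_le_norm _).trans ((f n).unit_le_opNorm _ hx1)
    have h2 := (RCLike.re_le_norm _).trans (g.unit_le_opNorm _ hx1)
    have h3 := min_le_left (α n) (1 / 2)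
    have h4 := min_le_right (α n) (1 / 2)
    exact ⟨d • y, mem_closedBall_zero_iff.2 hx1, by linarith, by linarith⟩
  choose x hxB hxf hxg using hx
  have hmem := hdet (Set.range x) (Set.range_subset_iff.2 hxB) fun n => by
    refine ⟨x n, ⟨n, rfl⟩, ?_⟩
    rw [hVs n]
    refine ⟨hxB n, lt_of_le_of_lt ?_ (hxf n)⟩
    refine sub_le_sub_right (csSup_le (Set.Nonempty.image _ ⟨x n, hxB n⟩) ?_) _
    rintro _ ⟨b, hb, rfl⟩
    exact (RCLike.re_le_norm _).trans ((f n).unit_le_opNorm _ (mem_closedBall_zero_iff.1 hb))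
  have hsub : closure (convexHull ℝ (Set.range x)) ⊆ {y | 1 / 2 ≤ RCLike.re (g y)} := by
    refine closure_minimal (convexHull_min ?_ ?_) (isClosed_le continuous_const (by fun_prop))
    · exact Set.range_subset_iff.2 fun n => (hxg n).le
    · refine convex_halfSpace_ge ⟨fun y z => by simp, fun r y => ?_⟩ _
      rw [RCLike.real_smul_eq_coe_smul (K := 𝕜), map_smul, smul_eq_mul, RCLike.re_ofReal_mul,
        smul_eq_mul]
  have : (1 / 2 : ℝ) ≤ RCLike.re (g a) := hsub hmem
  linarith

theorem theorem2p14 (𝕜 : Type u) (X : Type v) [RCLike 𝕜] [NormedAddCommGroup X]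
    [NormedSpace 𝕜 X] [NormedSpace ℝ X] [IsScalarTower ℝ 𝕜 X] [CompleteSpace X]
    (hX : IsL1Predual.{w, u, v} 𝕜 X) :
    (Countable (Quotient (extSetoid 𝕜 X)) →
      scdPoints 𝕜 (Metric.closedBall (0 : X) 1) = Metric.closedBall (0 : X) 1) ∧
    (Uncountable (Quotient (extSetoid 𝕜 X)) →
      scdPoints 𝕜 (Metric.closedBall (0 : X) 1) = ∅) := by
  refine ⟨fun _ => ?_, fun _ => ?_⟩
  · have := separableSpace_strongDual_of_countable (𝕜 := 𝕜) (X := X)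
    exact scdPoints_closedBall_eq_of_separable
  · exact scdPoints_closedBall_eq_empty (exists_norm_add_smul_eq_of_uncountable hX)
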